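/- Let $\mathcal T\subseteq\mathbb R$ be a compact set, let $\delta>4$ be an integer, and let $\Psi:\mathcal T\times\mathcal T\to\mathbb R$ be symmetric and positive semi-definite, i.e. for every finite set $\mathbf t\subseteq\mathcal T$ the matrix $\Psi(\mathbf t,\mathbf t)=(\Psi(s,u))_{s,u\in\mathbf t}$ is symmetric and positive semi-definite. Then there is a unique probability measure $\lambda$ on $\mathbb R^{\mathcal T\times\mathcal T}$ with its product $\sigma$-algebra such that, for every finite set $\mathbf t\subseteq\mathcal T$, the image of $\lambda$ under the projection $\Sigma\mapsto\Sigma(\mathbf t,\mathbf t)=(\Sigma(s,u))_{s,u\in\mathbf t}$ is the Inverse-Wishart law $\mathrm{IW}(\delta,\Psi(\mathbf t,\mathbf t))$ in Dawid's parametrization. This measure is denoted $\mathrm{IWP}(\delta,\Psi)$. Here, for a positive definite $p\times p$ matrix $\Psi_0$, $\mathrm{IW}(\delta,\Psi_0)$ is the law of $K^{-1}$, where $K$ is Wishart distributed with $\delta+p-1$ degrees of freedom and scale matrix $\Psi_0^{-1}$, i.e. $K=\sum_{k=1}^{\delta+p-1}x_kx_k^{\top}$ with $x_1,\dots,x_{\delta+p-1}$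 independent $N(0,\Psi_0^{-1})$ vectors. For a singular positive semi-definite $p\times p$ matrix $\Psi_0$, $\mathrm{IW}(\delta,\Psi_0)$ is the degenerate law of $\Psi_0^{1/2}\,W\,\Psi_0^{1/2}$, where $W\sim\mathrm{IW}(\delta,I_p)$. -/

import Mathlib

open MeasureTheory ProbabilityTheory

noncomputable section

/-- The entrywise (product) σ-algebra on real matrices; for finite index types it is the Borel
σ-algebra of the finite-dimensional space of matrices. -/
instance matrixMeasurableSpace {m n : Type*} : MeasurableSpace (Matrix m n ℝ) :=
  inferInstanceAs (MeasurableSpace (m → n → ℝ))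

variable {ι : Type*} [Fintype ι] [DecidableEq ι]

/-- The Wishart distribution with `ν` degrees of freedom and scale matrix `S`: the law of
`∑ k, x k * (x k)ᵀ` for `ν` independent `N(0, S)` random vectors `x k`. -/
def wishart (ν : ℕ) (S : Matrix ι ι ℝ) : Measure (Matrix ι ι ℝ) :=
  (Measure.pi fun _ : Fin ν => multivariateGaussian (0 : EuclideanSpace ℝ ι) S).map
    fun x => ∑ k, Matrix.vecMulVec (x k).ofLp (x k).ofLp

/-- The Inverse-Wishart distribution in Dawid's parametrization for a positive definite `p × p`
scale matrix `Ψ`: the law of `K⁻¹`, where `K` is Wishart distributed with `δ + p - 1` degrees of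
freedom and scale matrix `Ψ⁻¹`. -/
def inverseWishartOfPosDef (δ : ℕ) (Ψ : Matrix ι ι ℝ) : Measure (Matrix ι ι ℝ) :=
  (wishart (δ + Fintype.card ι - 1) Ψ⁻¹).map fun K => K⁻¹

open scoped MatrixOrder in
open Classical in
/-- The Inverse-Wishart distribution `IW(δ, Ψ)` in Dawid's parametrization for a positive
semi-definite scale matrix `Ψ`. If `Ψ` is positive definite it is the law of the inverse of a
Wishart matrix, as above. If `Ψ` is singular it is the degenerate law of `Ψ^(1/2) * W * Ψ^(1/2)`
with `W ∼ IW(δ, 1)`, the standard extension by congruence. -/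
def inverseWishart (δ : ℕ) (Ψ : Matrix ι ι ℝ) : Measure (Matrix ι ι ℝ) :=
  if Ψ.PosDef then inverseWishartOfPosDef δ Ψ
  else (inverseWishartOfPosDef δ (1 : Matrix ι ι ℝ)).map
    fun W => CFC.sqrt Ψ * W * CFC.sqrt Ψ

/-- The matrix `F(t, t)` of the values of a function `F` of two variables on the grid `t × t`. -/
def gridMatrix {T : Type*} (t : Finset T) (F : T × T → ℝ) : Matrix t t ℝ :=
  Matrix.of fun i j => F (i, j)

/-- A symmetric and positive semi-definite mapping: its evaluation on every finite grid is a
symmetric positive semi-definite matrix (over `ℝ`, `Matrix.PosSemidef` includes symmetry). -/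
def IsPosSemidefKernel {T : Type*} (Ψ : T × T → ℝ) : Prop :=
  ∀ t : Finset T, (gridMatrix t Ψ).PosSemidef

open Classical in
/-- `μ` is an Inverse-Wishart process `IWP(δ, Ψ)`: a probability measure on `ℝ^(T × T)` with the
product σ-algebra, whose projection on every finite grid `t × t` is `IW(δ, Ψ(t, t))`. -/
def IsInverseWishartProcess {T : Type*} (δ : ℕ) (Ψ : T × T → ℝ)
    (μ : Measure (T × T → ℝ)) : Prop :=
  IsProbabilityMeasure μ ∧
    ∀ t : Finset T, μ.map (gridMatrix t) = inverseWishart δ (gridMatrix t Ψ)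

end

/-! By Kolmogorov extension it suffices that the laws on finite grids are consistent: a principal
submatrix of an `IW(δ, Ψ)` matrix must again be Inverse-Wishart with the same `δ`. Uniqueness is
then that of projective limits.

Consistency starts with identity scale. Write `W = (Y Yᵀ)⁻¹` with `Y` standard Gaussian and delete
one row `g` of `Y`. The remaining block of `W` is the inverse of a Schur complement, which is the
Gram matrix of the other rows projected onto the orthogonal complement of `g`. In an orthonormal
basis of that complement the projections are again standard Gaussian, with one coordinate fewer.
Thus rows and columns drop together, which is why `δ`, the number of columns minus the number of
rows plus one, is the consistent parameter (`inverseGramGaussian_map_toBlocks₁₁`).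

For general scale, the law of `A W Aᵀ` with `W ∼ IW(δ, 1)` depends only on `A Aᵀ`, even for
rectangular `A` of different widths (`stdInverseWishart_map_conj_eq`). Since `IW(δ, Ψ)` is such a
law with `A Aᵀ = Ψ`, taking a submatrix merely selects rows of `A`. Singular and positive definite
scales are thereby treated alike. -/

/-! ### Kolmogorov extension for real-valued processes -/

section KolmogorovExtension

open Filter Topology Set
open scoped ENNReal

/-- Cylinders over compact nonempty bases in a real product space have the finite intersection
property for countable families. -/
theorem nonempty_iInter_cylinder_of_isCompact {ι : Type*} {s : ℕ → Finset ι}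
    {K : ∀ n, Set (s n → ℝ)} (hK : ∀ n, IsCompact (K n))
    (hne : ∀ n, (⋂ k ≤ n, cylinder (α := fun _ => ℝ) (s k) (K k)).Nonempty) :
    (⋂ n, cylinder (α := fun _ => ℝ) (s n) (K n)).Nonempty := by
  classical
  -- A compact box for Tychonoff: coordinate `i` is confined by the first base that involves it.
  let Q : ι → Set ℝ := fun i =>
    if h : ∃ n, i ∈ s n then (fun x : s (Nat.find h) → ℝ => x ⟨i, Nat.find_spec h⟩) '' K (Nat.find h)
    else {0}
  have hQc : ∀ i, IsCompact (Q i) := fun i => by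
    by_cases h : ∃ n, i ∈ s n
    · simp only [Q, dif_pos h]
      exact (hK _).image (continuous_apply _)
    · simp only [Q, dif_neg h]
      exact isCompact_singleton
  have hKne : ∀ n, (K n).Nonempty := fun n => by
    obtain ⟨x, hx⟩ := hne n
    exact ⟨_, mem_iInter₂.1 hx n le_rfl⟩
  have hQne : ∀ i, (Q i).Nonempty := fun i => by
    by_cases h : ∃ n, i ∈ s n
    · simp only [Q, dif_pos h]
      exact (hKne _).image _
    · simp only [Q, dif_neg h]
      exact singleton_nonempty _
  choose q hq using hQne
  have hclosed : ∀ n, IsClosed (cylinder (α := fun _ => ℝ) (s n) (K n)) := fun n =>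
    (hK n).isClosed.preimage (by unfold Finset.restrict; fun_prop)
  have hpi : IsCompact (Set.pi univ Q) := isCompact_univ_pi hQc
  let F : ℕ → Set (ι → ℝ) := fun n => Set.pi univ Q ∩ ⋂ k ≤ n, cylinder (α := fun _ => ℝ) (s k) (K k)
  have hFclosed : ∀ n, IsClosed (F n) := fun n =>
    hpi.isClosed.inter (isClosed_biInter fun k _ => hclosed k)
  have hFne : ∀ n, (F n).Nonempty := fun n => by
    obtain ⟨x, hx⟩ := hne n
    -- The first `n + 1` cylinders see only the coordinates kept from `x`. The first base involving
    -- such a coordinate has index at most `n`, so the new point lies in the box.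
    refine ⟨fun i => if ∃ k ≤ n, i ∈ s k then x i else q i, fun i _ => ?_, mem_iInter₂.2 fun k hk => ?_⟩
    · by_cases h : ∃ k ≤ n, i ∈ s k
      · simp only [if_pos h]
        obtain ⟨k, hk, hik⟩ := h
        have h' : ∃ n, i ∈ s n := ⟨k, hik⟩
        simp only [Q, dif_pos h']
        exact ⟨_, mem_iInter₂.1 hx _ ((Nat.find_min' h' hik).trans hk), rfl⟩
      · simp only [if_neg h]
        exact hq i
    · have hxk := mem_iInter₂.1 hx k hk
      rw [mem_cylinder] at hxk ⊢
      convert hxk using 1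
      ext i
      exact if_pos ⟨k, hk, i.2⟩
  have := IsCompact.nonempty_iInter_of_sequence_nonempty_isCompact_isClosed F
    (fun n => inter_subset_inter_right _ fun x hx => mem_iInter₂.2 fun k hk =>
      mem_iInter₂.1 hx k (hk.trans n.le_succ)) hFne
    (hpi.inter_right (isClosed_biInter fun k _ => hclosed k)) hFclosed
  obtain ⟨x, hx⟩ := this
  exact ⟨x, mem_iInter.2 fun n => mem_iInter₂.1 (mem_iInter.1 hx n).2 n le_rfl⟩

variable {ι : Type*} {P : ∀ J : Finset ι, Measure (∀ _ : J, ℝ)} [∀ J, IsProbabilityMeasure (P J)]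

/-- Inner regularity replaces the bases by compact ones at a total cost below the supposed positive
limit `ε`. If finitely many compact cylinders had empty intersection, the losses would cover some `A
n`, of content at least `ε`. Hence compactness gives a point in all of them. -/
theorem projectiveFamilyContent_tendsto_zero
    (hP : IsProjectiveMeasureFamily (α := fun _ : ι => ℝ) P)
    {A : ℕ → Set (ι → ℝ)} (hA : ∀ n, A n ∈ measurableCylinders fun _ : ι => ℝ)
    (hanti : Antitone A) (hinter : ⋂ n, A n = ∅) :
    Tendsto (fun n => projectiveFamilyContent hP (A n)) atTop (𝓝 0) := by
  set m := projectiveFamilyContent hP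
  have hmono : Antitone fun n => m (A n) := fun a b hab =>
    projectiveFamilyContent_mono hP (hA b) (hA a) (hanti hab)
  have hlim := tendsto_atTop_iInf hmono
  suffices h : ⨅ n, m (A n) = 0 by rwa [h] at hlim
  by_contra hε
  set ε := ⨅ n, m (A n)
  have hεle : ∀ n, ε ≤ m (A n) := fun n => iInf_le _ n
  obtain ⟨d, hdpos, hdsum⟩ := ENNReal.exists_pos_sum_of_countable' hε ℕ
  choose s S mS hAS using fun n => (mem_measurableCylinders _).1 (hA n)
  have hex : ∀ n, ∃ K ⊆ S n, IsCompact K ∧ P (s n) (S n \ K) < d n := fun n =>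
    (mS n).exists_isCompact_sdiff_lt (measure_ne_top _ _) (hdpos n).ne'
  choose K hKS hKc hKd using hex
  let C : ℕ → Set (ι → ℝ) := fun n => cylinder (α := fun _ => ℝ) (s n) (K n)
  have hC : ∀ n, C n ∈ measurableCylinders fun _ : ι => ℝ := fun n =>
    cylinder_mem_measurableCylinders _ _ (hKc n).measurableSet
  have hdiff : ∀ n, m (A n \ C n) < d n := fun n => by
    have : A n \ C n = cylinder (α := fun _ => ℝ) (s n) (S n \ K n) := by
      rw [hAS n]; rfl
    rw [this]
    exact (projectiveFamilyContent_cylinder hP ((mS n).diff (hKc n).measurableSet)).trans_lt (hKd n)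
  have hring : IsSetRing (measurableCylinders fun _ : ι => ℝ) := isSetRing_measurableCylinders
  have hCne : (⋂ n, C n).Nonempty := by
    refine nonempty_iInter_cylinder_of_isCompact hKc fun n => ?_
    by_contra hemp
    rw [not_nonempty_iff_eq_empty] at hemp
    have hsub : A n ⊆ ⋃ k ∈ Finset.range (n + 1), A k \ C k := fun x hx => by
      by_contra hx'
      have : x ∈ (∅ : Set (ι → ℝ)) := by
        rw [← hemp]
        refine mem_iInter₂.2 fun k hk => ?_
        by_contra hxk
        exact hx' (mem_iUnion₂.2 ⟨k, Finset.mem_range_succ_iff.2 hk, hanti hk hx, hxk⟩)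
      exact this
    have hD : ∀ k, A k \ C k ∈ measurableCylinders fun _ : ι => ℝ := fun k =>
      hring.sdiff_mem (hA k) (hC k)
    have : m (A n) < ε := calc
      m (A n) ≤ m (⋃ k ∈ Finset.range (n + 1), A k \ C k) :=
        projectiveFamilyContent_mono hP (hA n) (hring.biUnion_mem _ fun k _ => hD k) hsub
      _ ≤ ∑ k ∈ Finset.range (n + 1), m (A k \ C k) :=
        addContent_biUnion_le hring fun k _ => hD k
      _ ≤ ∑ k ∈ Finset.range (n + 1), d k := Finset.sum_le_sum fun k _ => (hdiff k).le
      _ ≤ ∑' k, d k := ENNReal.sum_le_tsum _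
      _ < ε := hdsum
    exact absurd (hεle n) this.not_ge
  obtain ⟨x, hx⟩ := hCne
  have : x ∈ ⋂ n, A n := mem_iInter.2 fun n => by
    rw [hAS n]
    exact hKS n (mem_iInter.1 hx n)
  rw [hinter] at this
  exact this

/-- The Kolmogorov extension theorem for real-valued processes. -/
theorem exists_isProjectiveLimit_real
    (hP : IsProjectiveMeasureFamily (α := fun _ : ι => ℝ) P) :
    ∃ μ : Measure (ι → ℝ), IsProjectiveLimit (α := fun _ => ℝ) μ P := by
  have hsub : (projectiveFamilyContent hP).IsSigmaSubadditive := by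
    refine isSigmaSubadditive_of_addContent_iUnion_eq_tsum
      isSetRing_measurableCylinders (fun f hf hf_Union hf' ↦ ?_)
    exact addContent_iUnion_eq_sum_of_tendsto_zero isSetRing_measurableCylinders
      (projectiveFamilyContent hP) (fun s hs ↦ projectiveFamilyContent_ne_top _)
      (fun _ ↦ projectiveFamilyContent_tendsto_zero hP) hf hf_Union hf'
  refine ⟨(projectiveFamilyContent hP).measure isSetSemiring_measurableCylinders
    generateFrom_measurableCylinders.ge hsub, fun I => ?_⟩
  ext s hs
  rw [Measure.map_apply (Finset.measurable_restrict I) hs, AddContent.measure_eq, ← cylinder,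
    projectiveFamilyContent_cylinder hP hs]
  · exact generateFrom_measurableCylinders.symm
  · exact cylinder_mem_measurableCylinders _ _ hs

end KolmogorovExtension

/-! ### Gram matrices, orthogonal matrices and Schur complements -/

section LinearAlgebra

open Matrix

/-- Two real matrices with the same Gram matrix of rows differ by an orthogonal matrix. -/
theorem Matrix.exists_orthogonal_of_mul_transpose_eq {q m : Type*} [Fintype q] [DecidableEq q]
    [Fintype m] [DecidableEq m] {A B : Matrix q m ℝ} (h : A * Aᵀ = B * Bᵀ) :
    ∃ O : Matrix m m ℝ, Oᵀ * O = 1 ∧ A * O = B := by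
  let f := Matrix.toEuclideanLin Aᵀ
  let g := Matrix.toEuclideanLin Bᵀ
  have inner_eq : ∀ (C : Matrix q m ℝ) (x y : EuclideanSpace ℝ q),
      inner ℝ (Matrix.toEuclideanLin Cᵀ x) (Matrix.toEuclideanLin Cᵀ y) =
        y.ofLp ⬝ᵥ (C * Cᵀ) *ᵥ x.ofLp := fun C x y => by
    rw [EuclideanSpace.inner_eq_star_dotProduct]
    simp only [Matrix.ofLp_toLpLin, Matrix.toLin'_apply, star_trivial]
    rw [← Matrix.mulVec_mulVec, Matrix.dotProduct_mulVec y.ofLp, ← Matrix.mulVec_transpose]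
  have hnorm : ∀ x, ‖f x‖ = ‖g x‖ := fun x => by
    rw [norm_eq_sqrt_real_inner, norm_eq_sqrt_real_inner, inner_eq, inner_eq, h]
  -- The equality of norms makes `f x ↦ g x` a well-defined isometry on the range of `f`. A linear
  -- section `σ` expresses it as `g ∘ σ`, and it then extends to the whole space.
  obtain ⟨σ, hσ⟩ := f.rangeRestrict.exists_rightInverse_of_surjective f.range_rangeRestrict
  have hσ' : ∀ s : LinearMap.range f, f (σ s) = s := fun s =>
    congrArg Subtype.val (LinearMap.congr_fun hσ s)
  let L : LinearMap.range f →ₗᵢ[ℝ] EuclideanSpace ℝ m :=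
    { toLinearMap := g ∘ₗ σ
      norm_map' := fun s => by
        change ‖g (σ s)‖ = _
        rw [← hnorm, hσ']
        rfl }
  have hL : ∀ x, L.extend (f x) = g x := fun x => by
    have h1 : L.extend (f x) = g (σ ⟨f x, LinearMap.mem_range_self f x⟩) :=
      L.extend_apply ⟨f x, LinearMap.mem_range_self f x⟩
    rw [h1, ← sub_eq_zero, ← map_sub, ← norm_eq_zero, ← hnorm, map_sub, hσ', sub_self, norm_zero]
  let R : Matrix m m ℝ := Matrix.toEuclideanLin.symm L.extend.toLinearMap
  have hR : ∀ x, Matrix.toEuclideanLin R x = L.extend x := fun x => by simp [R]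
  have hRR : Rᵀ * R = 1 := by
    ext i j
    have h2 := L.extend.inner_map_map (EuclideanSpace.single i (1 : ℝ)) (EuclideanSpace.single j 1)
    rw [← hR, ← hR, EuclideanSpace.inner_eq_star_dotProduct] at h2
    simp only [Matrix.ofLp_toLpLin, Matrix.toLin'_apply, star_trivial] at h2
    simp only [PiLp.ofLp_single, Matrix.mulVec_single_one, EuclideanSpace.inner_single_left,
      map_one, one_mul] at h2
    rw [Matrix.mul_apply', dotProduct_comm]
    refine h2.trans ?_
    simp [Matrix.one_apply, Pi.single_apply]
  refine ⟨Rᵀ, by rw [Matrix.transpose_transpose]; exact mul_eq_one_comm.1 hRR, ?_⟩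
  rw [← Matrix.transpose_inj, Matrix.transpose_mul, Matrix.transpose_transpose]
  apply Matrix.toEuclideanLin.injective
  ext1 x
  rw [← hL x, ← hR]
  ext i
  simp [f, Matrix.toLpLin_apply]

/-- The upper left block of the inverse of a block matrix is the inverse of a Schur complement. This
holds for the total inverse, whether or not the block matrix is invertible. -/
theorem Matrix.toBlocks₁₁_inv_fromBlocks {R m n : Type*} [Field R] [Fintype m] [Fintype n]
    [DecidableEq m] [DecidableEq n] (A : Matrix m m R) (B : Matrix m n R) (C : Matrix n m R)
    {D : Matrix n n R} (hD : IsUnit D) :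
    (fromBlocks A B C D)⁻¹.toBlocks₁₁ = (A - B * D⁻¹ * C)⁻¹ := by
  let := hD.invertible
  have hdet := det_fromBlocks₂₂ A B C D
  rw [invOf_eq_nonsing_inv] at hdet
  have hDdet : D.det ≠ 0 := ((Matrix.isUnit_iff_isUnit_det _).1 hD).ne_zero
  -- The block matrix and the Schur complement are singular together, and then both inverses take
  -- the default value `0`.
  by_cases hS : (A - B * D⁻¹ * C).det = 0
  · rw [hS, mul_zero] at hdet
    rw [nonsing_inv_apply_not_isUnit _ (by rw [hdet]; exact not_isUnit_zero),
      nonsing_inv_apply_not_isUnit _ (by rw [hS]; exact not_isUnit_zero)]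
    rfl
  · let iS : Invertible (A - B * ⅟D * C) := invertibleOfIsUnitDet _ (by
      rw [invOf_eq_nonsing_inv]; exact isUnit_iff_ne_zero.2 hS)
    let iM : Invertible (fromBlocks A B C D) := invertibleOfIsUnitDet _ (by
      rw [hdet]; exact isUnit_iff_ne_zero.2 (mul_ne_zero hDdet hS))
    rw [← invOf_eq_nonsing_inv (fromBlocks A B C D), invOf_fromBlocks₂₂_eq, toBlocks_fromBlocks₁₁,
      invOf_eq_nonsing_inv, invOf_eq_nonsing_inv]

/-- The upper left block of the inverse of the Gram matrix of the rows of `G` and one row `g ≠ 0`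
is the inverse of the Gram matrix of the coordinates of the rows of `G` along the orthogonal
complement of `g`. -/
theorem Matrix.exists_toBlocks₁₁_inv_gram_fromRows {ι κ : Type*} [Fintype ι] [DecidableEq ι] [Fintype κ]
    [DecidableEq κ] {g : Matrix Unit (κ ⊕ Unit) ℝ} (hg : g ≠ 0) :
    ∃ V : Matrix (κ ⊕ Unit) κ ℝ, Vᵀ * V = 1 ∧ ∀ G : Matrix ι (κ ⊕ Unit) ℝ,
      (fromRows G g * (fromRows G g)ᵀ)⁻¹.toBlocks₁₁ = (G * V * (G * V)ᵀ)⁻¹ := by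
  let w : EuclideanSpace ℝ (κ ⊕ Unit) := WithLp.toLp 2 (g ())
  have hw : w ≠ 0 := fun h => hg (by
    ext i j
    exact congrArg (fun v : EuclideanSpace ℝ (κ ⊕ Unit) => v j) h)
  have hc : ‖w‖ ≠ 0 := norm_ne_zero_iff.2 hw
  have horth : Orthonormal ℝ (({Sum.inr ()} : Set (κ ⊕ Unit)).domRestrict
      fun _ : κ ⊕ Unit => ‖w‖⁻¹ • w) := by
    refine ⟨fun i => ?_, fun i j hij => absurd (Subsingleton.elim i j) hij⟩
    simp [Set.domRestrict, norm_smul, hc]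
  obtain ⟨b, hb⟩ := horth.exists_orthonormalBasis_extension_of_card_eq (by simp)
  have hb' : b (Sum.inr ()) = ‖w‖⁻¹ • w := hb _ rfl
  let U : Matrix (κ ⊕ Unit) (κ ⊕ Unit) ℝ := Matrix.of fun i j => b j i
  have hUU : Uᵀ * U = 1 := by
    ext i j
    have := orthonormal_iff_ite.1 b.orthonormal i j
    rw [EuclideanSpace.inner_eq_star_dotProduct, star_trivial, dotProduct_comm] at this
    rw [Matrix.mul_apply', Matrix.one_apply, ← this]
    rfl
  have hUU' : U * Uᵀ = 1 := mul_eq_one_comm.1 hUU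
  let u := U.toCols₂
  have hU : U = fromCols U.toCols₁ u := (fromCols_toCols U).symm
  have hgu : g = ‖w‖ • uᵀ := by
    ext i j
    have h1 : u j i = ‖w‖⁻¹ * w j := congrArg (fun v : EuclideanSpace ℝ (κ ⊕ Unit) => v j) hb'
    rw [Matrix.smul_apply, Matrix.transpose_apply, h1, smul_eq_mul, mul_inv_cancel_left₀ hc]
  rw [hU, transpose_fromCols, fromRows_mul_fromCols, ← fromBlocks_one, fromBlocks_inj] at hUU
  rw [hU, transpose_fromCols, fromCols_mul_fromRows] at hUU'
  have hggT : g * gᵀ = (‖w‖ ^ 2) • (1 : Matrix Unit Unit ℝ) := by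
    rw [hgu, transpose_smul, transpose_transpose, smul_mul, Matrix.mul_smul, hUU.2.2.2, smul_smul, sq]
  have hinv : (g * gᵀ)⁻¹ = (‖w‖ ^ 2)⁻¹ • (1 : Matrix Unit Unit ℝ) := by
    apply inv_eq_left_inv
    rw [hggT, smul_mul, Matrix.mul_smul, smul_smul, inv_mul_cancel₀ (pow_ne_zero 2 hc), one_smul, one_mul]
  refine ⟨U.toCols₁, hUU.1, fun G => ?_⟩
  have hunit : IsUnit (g * gᵀ) := by
    rw [Matrix.isUnit_iff_isUnit_det, hggT]
    simp [hc]
  rw [transpose_fromRows, fromRows_mul_fromCols, toBlocks₁₁_inv_fromBlocks _ _ _ hunit, hinv]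
  congr 1
  -- The orthogonal projection onto the line of `g`; its complement is `V * Vᵀ` with `V =
  -- U.toCols₁`.
  have hproj : gᵀ * ((‖w‖ ^ 2)⁻¹ • (1 : Matrix Unit Unit ℝ)) * g = u * uᵀ := by
    simp only [hgu, transpose_smul, transpose_transpose, Matrix.mul_smul, Matrix.smul_mul,
      Matrix.mul_one, smul_smul]
    rw [show ‖w‖ * ((‖w‖ ^ 2)⁻¹ * ‖w‖) = 1 by field_simp, one_smul]
  calc G * Gᵀ - G * gᵀ * ((‖w‖ ^ 2)⁻¹ • (1 : Matrix Unit Unit ℝ)) * (g * Gᵀ)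
      = G * (1 - gᵀ * ((‖w‖ ^ 2)⁻¹ • (1 : Matrix Unit Unit ℝ)) * g) * Gᵀ := by
        simp only [Matrix.mul_sub, Matrix.sub_mul, Matrix.mul_one, Matrix.mul_assoc]
    _ = G * U.toCols₁ * (G * U.toCols₁)ᵀ := by
        rw [hproj, ← hUU', add_sub_cancel_right, transpose_mul]
        simp only [Matrix.mul_assoc]

end LinearAlgebra

/-! ### Standard Gaussian matrices and their orthogonal invariance -/

section GaussianMatrix

open Matrix

theorem map_ofLp_stdGaussian (α : Type*) [Fintype α] :
    (stdGaussian (EuclideanSpace ℝ α)).map WithLp.ofLp = Measure.pi fun _ : α => gaussianReal 0 1 := by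
  rw [← map_pi_eq_stdGaussian, Measure.map_map (by fun_prop) (by fun_prop)]
  exact Measure.map_id

/-- The standard Gaussian characteristic function depends only on the norm of its argument, and `Vᵀ
* V = 1` makes `t ↦ V *ᵥ t` isometric. -/
theorem map_vecMul_pi_gaussianReal {α κ : Type*} [Fintype α] [Fintype κ] [DecidableEq κ]
    {V : Matrix α κ ℝ} (hV : Vᵀ * V = 1) :
    (Measure.pi fun _ : α => gaussianReal 0 1).map (fun x => x ᵥ* V) =
      Measure.pi fun _ : κ => gaussianReal 0 1 := by
  let S : EuclideanSpace ℝ α → EuclideanSpace ℝ κ := fun x => WithLp.toLp 2 (x.ofLp ᵥ* V)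
  have hSc : Continuous S := by
    refine (PiLp.continuous_toLp 2 _).comp (continuous_pi fun j => ?_)
    simp only [vecMul, dotProduct]
    fun_prop
  have hS : (stdGaussian (EuclideanSpace ℝ α)).map S = stdGaussian (EuclideanSpace ℝ κ) := by
    have : IsProbabilityMeasure ((stdGaussian (EuclideanSpace ℝ α)).map S) :=
      Measure.isProbabilityMeasure_map hSc.measurable.aemeasurable
    apply Measure.ext_of_charFun
    ext t
    have hinner : ∀ x, inner ℝ (S x) t = inner ℝ x (WithLp.toLp 2 (V *ᵥ t.ofLp)) := fun x => by
      simp only [S, EuclideanSpace.inner_eq_star_dotProduct, star_trivial]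
      rw [dotProduct_comm, dotProduct_comm (V *ᵥ _), dotProduct_mulVec]
    have hnorm : ‖(WithLp.toLp 2 (V *ᵥ t.ofLp) : EuclideanSpace ℝ α)‖ ^ 2 = ‖t‖ ^ 2 := by
      rw [← real_inner_self_eq_norm_sq, ← real_inner_self_eq_norm_sq]
      simp only [EuclideanSpace.inner_eq_star_dotProduct, star_trivial]
      rw [dotProduct_mulVec, ← mulVec_transpose, mulVec_mulVec, hV, one_mulVec]
    rw [charFun_apply, integral_map hSc.measurable.aemeasurable (by fun_prop)]
    simp_rw [hinner]
    rw [← charFun_apply, charFun_stdGaussian, charFun_stdGaussian]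
    norm_cast
    rw [hnorm]
  rw [← map_ofLp_stdGaussian, ← map_ofLp_stdGaussian, ← hS,
    Measure.map_map (by fun_prop) hSc.measurable, Measure.map_map (by
      exact measurable_pi_lambda _ fun j => by simp only [vecMul, dotProduct]; fun_prop) (by fun_prop)]
  rfl

/-- The law of a matrix with independent standard Gaussian entries. -/
noncomputable def gaussianMatrix (ι κ : Type*) [Fintype ι] [Fintype κ] : Measure (Matrix ι κ ℝ) :=
  (Measure.pi fun _ => Measure.pi fun _ => gaussianReal 0 1 : Measure (ι → κ → ℝ))

instance (ι κ : Type*) [Fintype ι] [Fintype κ] : IsProbabilityMeasure (gaussianMatrix ι κ) :=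
  inferInstanceAs (IsProbabilityMeasure
    (Measure.pi fun _ => Measure.pi fun _ => gaussianReal 0 1 : Measure (ι → κ → ℝ)))

theorem Matrix.measurable_of_entries {Ω ι κ : Type*} [MeasurableSpace Ω] {f : Ω → Matrix ι κ ℝ}
    (hf : ∀ i j, Measurable fun ω => f ω i j) : Measurable f :=
  measurable_pi_lambda _ fun i => measurable_pi_lambda _ fun j => hf i j

theorem Matrix.measurable_entry {ι κ : Type*} (i : ι) (j : κ) :
    Measurable fun M : Matrix ι κ ℝ => M i j :=
  (measurable_pi_apply j).comp (measurable_pi_apply i)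

theorem Measurable.matrix_entry {Ω ι κ : Type*} [MeasurableSpace Ω] {f : Ω → Matrix ι κ ℝ}
    (hf : Measurable f) (i : ι) (j : κ) : Measurable fun ω => f ω i j :=
  (Matrix.measurable_entry i j).comp hf

theorem Measurable.matrix_mul {Ω ι κ μ : Type*} [MeasurableSpace Ω] [Fintype κ]
    {f : Ω → Matrix ι κ ℝ} {g : Ω → Matrix κ μ ℝ} (hf : Measurable f) (hg : Measurable g) :
    Measurable fun ω => f ω * g ω :=
  Matrix.measurable_of_entries fun i j => by
    simp only [Matrix.mul_apply]
    exact Finset.measurable_sum _ fun k _ => (hf.matrix_entry i k).mul (hg.matrix_entry k j)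

theorem Measurable.matrix_transpose {Ω ι κ : Type*} [MeasurableSpace Ω]
    {f : Ω → Matrix ι κ ℝ} (hf : Measurable f) : Measurable fun ω => (f ω)ᵀ :=
  Matrix.measurable_of_entries fun i j => hf.matrix_entry j i

theorem Measurable.matrix_submatrix {Ω ι κ ι' κ' : Type*} [MeasurableSpace Ω]
    {f : Ω → Matrix ι κ ℝ} (hf : Measurable f) (a : ι' → ι) (b : κ' → κ) :
    Measurable fun ω => (f ω).submatrix a b :=
  Matrix.measurable_of_entries fun i j => hf.matrix_entry (a i) (b j)

theorem Measurable.matrix_det {Ω ι : Type*} [MeasurableSpace Ω] [Fintype ι] [DecidableEq ι]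
    {f : Ω → Matrix ι ι ℝ} (hf : Measurable f) : Measurable fun ω => (f ω).det := by
  simp only [Matrix.det_apply]
  exact Finset.measurable_sum _ fun σ _ =>
    (Finset.measurable_prod _ fun i _ => hf.matrix_entry (σ i) i).const_smul (Equiv.Perm.sign σ)

theorem Measurable.matrix_inv {Ω ι : Type*} [MeasurableSpace Ω] [Fintype ι] [DecidableEq ι]
    {f : Ω → Matrix ι ι ℝ} (hf : Measurable f) : Measurable fun ω => (f ω)⁻¹ :=
  Matrix.measurable_of_entries fun i j => by
    simp only [Matrix.inv_def, Matrix.smul_apply, smul_eq_mul, Ring.inverse_eq_inv,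
      Matrix.adjugate_apply]
    refine hf.matrix_det.inv.mul (Measurable.matrix_det (Matrix.measurable_of_entries fun k l => ?_))
    by_cases h : k = j
    · subst h
      simp only [Matrix.updateRow_self]
      exact measurable_const
    · simp only [Matrix.updateRow_ne h]
      exact hf.matrix_entry k l

theorem gaussianMatrix_map_mul_right {ι κ κ' : Type*} [Fintype ι] [Fintype κ] [Fintype κ']
    [DecidableEq κ'] {V : Matrix κ κ' ℝ} (hV : Vᵀ * V = 1) :
    (gaussianMatrix ι κ).map (fun Y => Y * V) = gaussianMatrix ι κ' := by
  have hm : Measurable fun x : κ → ℝ => x ᵥ* V :=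
    measurable_pi_lambda _ fun j => by simp only [vecMul, dotProduct]; fun_prop
  have hr := map_vecMul_pi_gaussianReal hV
  have : IsProbabilityMeasure ((Measure.pi fun _ : κ => gaussianReal 0 1).map fun x => x ᵥ* V) :=
    Measure.isProbabilityMeasure_map hm.aemeasurable
  have h := Measure.pi_map_pi (ι := ι) (μ := fun _ => Measure.pi fun _ : κ => gaussianReal 0 1)
    (f := fun _ x => x ᵥ* V) fun _ => hm.aemeasurable
  simp only [hr] at h
  exact h

/-- With a single product over pairs, transposition is a reindexing of coordinates. -/
theorem gaussianMatrix_eq_map_infinitePi (ι κ : Type*) [Fintype ι] [Fintype κ] :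
    gaussianMatrix ι κ = (Measure.infinitePi fun _ : ι × κ => gaussianReal 0 1).map
      fun x => Matrix.of fun i j => x (i, j) := by
  have h := Measure.infinitePi_map_curry (fun (_ : ι) (_ : κ) => gaussianReal 0 1)
  simp only [Measure.infinitePi_eq_pi] at h ⊢
  exact h.symm

theorem gaussianMatrix_map_transpose {ι κ : Type*} [Fintype ι] [Fintype κ] :
    (gaussianMatrix ι κ).map (fun Y => Yᵀ) = gaussianMatrix κ ι := by
  have h := Measure.infinitePi_map_piCongrLeft (fun _ : κ × ι => gaussianReal 0 1)
    (Equiv.prodComm ι κ)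
  rw [gaussianMatrix_eq_map_infinitePi, gaussianMatrix_eq_map_infinitePi, ← h,
    Measure.map_map measurable_id'.matrix_transpose
      (Matrix.measurable_of_entries fun i j => measurable_pi_apply (i, j)),
    Measure.map_map (Matrix.measurable_of_entries fun i j => measurable_pi_apply (i, j))
      (MeasurableEquiv.measurable _)]
  rfl

theorem gaussianMatrix_map_mul_left {ι ι' κ : Type*} [Fintype ι] [Fintype ι'] [Fintype κ]
    [DecidableEq ι'] {W : Matrix ι' ι ℝ} (hW : W * Wᵀ = 1) :
    (gaussianMatrix ι κ).map (fun Y => W * Y) = gaussianMatrix ι' κ := by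
  rw [← gaussianMatrix_map_transpose (ι := κ), ← gaussianMatrix_map_transpose (ι := κ),
    ← gaussianMatrix_map_mul_right (V := Wᵀ) (by rwa [transpose_transpose]),
    Measure.map_map (measurable_const.matrix_mul measurable_id') measurable_id'.matrix_transpose,
    Measure.map_map measurable_id'.matrix_transpose (measurable_id'.matrix_mul measurable_const)]
  congr 1
  ext1 Y
  simp [transpose_mul]

end GaussianMatrix

/-! ### Inverse-Wishart laws with identity scale -/

section StdInverseWishart

open Matrix

theorem Measure.map_prod_eq_of_ae {α β γ : Type*} [MeasurableSpace α] [MeasurableSpace β]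
    [MeasurableSpace γ] {μ : Measure α} [SFinite μ] {ν : Measure β} [IsProbabilityMeasure ν]
    {ρ : Measure γ} {f : α × β → γ} (hf : Measurable f)
    (h : ∀ᵐ b ∂ν, μ.map (fun a => f (a, b)) = ρ) : (μ.prod ν).map f = ρ := by
  ext s hs
  rw [Measure.map_apply hf hs, Measure.prod_apply_symm (hf hs)]
  have : ∀ᵐ b ∂ν, μ ((fun a => (a, b)) ⁻¹' (f ⁻¹' s)) = ρ s := by
    filter_upwards [h] with b hb
    rw [← hb, Measure.map_apply (f := fun a => f (a, b)) (hf.comp measurable_prodMk_right) hs]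
    rfl
  rw [lintegral_congr_ae this, lintegral_const, measure_univ, mul_one]

/-- The law of the inverse of the Gram matrix of the rows of a standard Gaussian matrix. -/
noncomputable def inverseGramGaussian (ι κ : Type*) [Fintype ι] [DecidableEq ι] [Fintype κ] :
    Measure (Matrix ι ι ℝ) :=
  (gaussianMatrix ι κ).map fun Y => (Y * Yᵀ)⁻¹

theorem measurable_inverseGram {ι κ : Type*} [Fintype ι] [DecidableEq ι] [Fintype κ] :
    Measurable fun Y : Matrix ι κ ℝ => (Y * Yᵀ)⁻¹ :=
  (measurable_id'.matrix_mul measurable_id'.matrix_transpose).matrix_inv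

instance (ι κ : Type*) [Fintype ι] [DecidableEq ι] [Fintype κ] :
    IsProbabilityMeasure (inverseGramGaussian ι κ) :=
  Measure.isProbabilityMeasure_map measurable_inverseGram.aemeasurable

theorem gaussianMatrix_sum_eq_map_prod (ι ι' κ : Type*) [Fintype ι] [Fintype ι'] [Fintype κ] :
    gaussianMatrix (ι ⊕ ι') κ =
      ((gaussianMatrix ι κ).prod (gaussianMatrix ι' κ)).map fun p => fromRows p.1 p.2 := by
  have h := (measurePreserving_sumPiEquivProdPi_symm
    (fun _ : ι ⊕ ι' => Measure.pi fun _ : κ => gaussianReal 0 1)).map_eq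
  refine h.symm.trans ?_
  congr 1

theorem gaussianMatrix_ae_ne_zero (ι κ : Type*) [Fintype ι] [Fintype κ] [Nonempty ι] [Nonempty κ] :
    ∀ᵐ g ∂gaussianMatrix ι κ, g ≠ 0 := by
  obtain ⟨i⟩ := ‹Nonempty ι›
  obtain ⟨j⟩ := ‹Nonempty κ›
  have : NullSingletonClass (gaussianReal 0 1) := nullSingletonClass_gaussianReal one_ne_zero
  have : ∀ᵐ x ∂(Measure.pi fun _ : κ => gaussianReal 0 1), x j ≠ 0 :=
    (measurePreserving_eval (fun _ : κ => gaussianReal 0 1) j).quasiMeasurePreserving.ae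
      (Measure.ae_ne _ 0)
  have : ∀ᵐ g ∂(Measure.pi fun _ : ι => Measure.pi fun _ : κ => gaussianReal 0 1), g i j ≠ 0 :=
    (measurePreserving_eval (fun _ : ι => Measure.pi fun _ : κ => gaussianReal 0 1)
      i).quasiMeasurePreserving.ae this
  filter_upwards [this] with g hg h
  exact hg (congrFun (congrFun h i) j)

/-- Condition on the last row `g`, almost surely nonzero. The block is then the inverse Gram matrix
of `G * V` with `V` fixed and `Vᵀ * V = 1`, so its law does not depend on `g`. -/
theorem inverseGramGaussian_map_toBlocks₁₁ (ι κ : Type*) [Fintype ι] [DecidableEq ι] [Fintype κ]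
    [DecidableEq κ] :
    (inverseGramGaussian (ι ⊕ Unit) (κ ⊕ Unit)).map (fun W => W.submatrix Sum.inl Sum.inl) =
      inverseGramGaussian ι κ := by
  have hrows : Measurable fun p : Matrix ι (κ ⊕ Unit) ℝ × Matrix Unit (κ ⊕ Unit) ℝ =>
      fromRows p.1 p.2 := Matrix.measurable_of_entries fun i j => by
    cases i with
    | inl i => exact measurable_fst.matrix_entry i j
    | inr i => exact measurable_snd.matrix_entry i j
  rw [inverseGramGaussian, gaussianMatrix_sum_eq_map_prod,
    Measure.map_map measurable_inverseGram hrows,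
    Measure.map_map (measurable_id'.matrix_submatrix _ _) (measurable_inverseGram.comp hrows)]
  refine Measure.map_prod_eq_of_ae
    ((measurable_inverseGram.comp hrows).matrix_submatrix _ _) ?_
  filter_upwards [gaussianMatrix_ae_ne_zero Unit (κ ⊕ Unit)] with g hg
  obtain ⟨V, hV, hGV⟩ := Matrix.exists_toBlocks₁₁_inv_gram_fromRows (ι := ι) hg
  rw [inverseGramGaussian, ← gaussianMatrix_map_mul_right (ι := ι) hV,
    Measure.map_map measurable_inverseGram (measurable_id'.matrix_mul measurable_const)]
  congr 1
  ext1 G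
  exact hGV G

theorem Matrix.mul_transpose_submatrix_one {R ι κ : Type*} [CommRing R] [Fintype ι] [Fintype κ]
    [DecidableEq ι] [DecidableEq κ] (e : κ ≃ ι) :
    (1 : Matrix ι ι R).submatrix e id * ((1 : Matrix ι ι R).submatrix e id)ᵀ = 1 := by
  ext i j
  simp [Matrix.mul_apply, Matrix.one_apply]

/-- A permutation matrix preserves the Gaussian law and cancels in `Y * Yᵀ`. -/
theorem inverseGramGaussian_congr_right (ι : Type*) {κ κ' : Type*} [Fintype ι] [DecidableEq ι]
    [Fintype κ] [Fintype κ'] (f : κ' ≃ κ) :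
    inverseGramGaussian ι κ = inverseGramGaussian ι κ' := by
  classical
  have hV : (((1 : Matrix κ κ ℝ).submatrix f id)ᵀ)ᵀ * ((1 : Matrix κ κ ℝ).submatrix f id)ᵀ = 1 := by
    rw [transpose_transpose, mul_transpose_submatrix_one]
  have hV' : ((1 : Matrix κ κ ℝ).submatrix f id)ᵀ * ((1 : Matrix κ κ ℝ).submatrix f id) = 1 := by
    rw [transpose_submatrix, transpose_one, submatrix_mul_equiv _ _ id f id, Matrix.mul_one,
      submatrix_id_id]
  rw [inverseGramGaussian, inverseGramGaussian, ← gaussianMatrix_map_mul_right hV,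
    Measure.map_map measurable_inverseGram (measurable_id'.matrix_mul measurable_const)]
  congr 1
  ext1 Y
  simp only [Function.comp_apply, transpose_mul, transpose_transpose]
  rw [Matrix.mul_assoc, ← Matrix.mul_assoc _ᵀ, hV', Matrix.one_mul]

theorem inverseGramGaussian_map_conj {ι κ : Type*} [Fintype ι] [DecidableEq ι]
    [Fintype κ] {O : Matrix ι ι ℝ} (hO : O * Oᵀ = 1) :
    (inverseGramGaussian ι κ).map (fun W => O * W * Oᵀ) = inverseGramGaussian ι κ := by
  conv_rhs => rw [inverseGramGaussian, ← gaussianMatrix_map_mul_left hO]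
  rw [inverseGramGaussian, Measure.map_map
    ((measurable_const.matrix_mul measurable_id').matrix_mul measurable_const)
    measurable_inverseGram, Measure.map_map measurable_inverseGram
    (measurable_const.matrix_mul measurable_id')]
  congr 1
  ext1 Y
  have h1 : O⁻¹ = Oᵀ := inv_eq_right_inv hO
  have h2 : Oᵀ⁻¹ = O := inv_eq_left_inv hO
  simp only [Function.comp_apply, transpose_mul]
  rw [← Matrix.mul_assoc (O * Y), Matrix.mul_assoc O, Matrix.mul_inv_rev, Matrix.mul_assoc O Y,
    Matrix.mul_inv_rev, h1, h2]

theorem inverseGramGaussian_map_reindex {ι ι' : Type*} (κ : Type*) [Fintype ι] [DecidableEq ι]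
    [Fintype ι'] [DecidableEq ι'] [Fintype κ] (e : ι' ≃ ι) :
    (inverseGramGaussian ι κ).map (fun W => W.submatrix e e) = inverseGramGaussian ι' κ := by
  conv_rhs => rw [inverseGramGaussian,
    ← gaussianMatrix_map_mul_left (mul_transpose_submatrix_one (R := ℝ) e)]
  rw [inverseGramGaussian, Measure.map_map (measurable_id'.matrix_submatrix _ _)
    measurable_inverseGram, Measure.map_map measurable_inverseGram
    (measurable_const.matrix_mul measurable_id')]
  congr 1
  ext1 Y
  have : (1 : Matrix ι ι ℝ).submatrix e id * Y = Y.submatrix e id := by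
    ext i j
    simp [Matrix.mul_apply, Matrix.one_apply]
  simp only [Function.comp_apply, this, transpose_submatrix]
  rw [← inv_submatrix_equiv]
  rfl

/-- Induction on the number `n` of deleted indices: an index `j` missed by `e` is removed together
with one column. -/
theorem inverseGramGaussian_map_submatrix {ι : Type*} [Fintype ι] [DecidableEq ι] {ν : ℕ} (n : ℕ) :
    ∀ {ι' : Type*} [Fintype ι'] [DecidableEq ι'] (e : ι → ι') (_ : Function.Injective e)
      (_ : Fintype.card ι' = Fintype.card ι + n),
    (inverseGramGaussian ι' (Fin (ν + n))).map (fun W => W.submatrix e e) =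
      inverseGramGaussian ι (Fin ν) := by
  induction n with
  | zero =>
    intro ι' _ _ e he hcard
    exact inverseGramGaussian_map_reindex (Fin ν) (Equiv.ofBijective e
      ((Fintype.bijective_iff_injective_and_card e).2 ⟨he, hcard.symm⟩))
  | succ n ih =>
    intro ι' _ _ e he hcard
    have hns : ¬ Function.Surjective e := fun hs => by
      have := Fintype.card_le_of_surjective e hs
      omega
    obtain ⟨j, hj⟩ := not_forall.1 hns
    let e' : ι → {x // x ≠ j} := fun i => ⟨e i, fun h => hj ⟨i, h⟩⟩
    have he' : Function.Injective e' := fun a b h => he (congrArg Subtype.val h)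
    let : Unique {x // ¬ x ≠ j} := ⟨⟨⟨j, not_not.2 rfl⟩⟩, fun x => Subtype.ext (not_not.1 x.2)⟩
    let E : {x // x ≠ j} ⊕ Unit ≃ ι' :=
      (Equiv.sumCongr (Equiv.refl _) (Equiv.ofUnique Unit {x // ¬ x ≠ j})).trans
        (Equiv.sumCompl fun x => x ≠ j)
    have hcard' : Fintype.card {x // x ≠ j} = Fintype.card ι + n := by
      have := Fintype.card_congr E
      rw [Fintype.card_sum, Fintype.card_unit, hcard] at this
      omega
    let F : Fin (ν + (n + 1)) ≃ Fin (ν + n) ⊕ Unit :=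
      Fintype.equivOfCardEq (by simp [add_assoc])
    rw [← ih e' he' hcard', ← inverseGramGaussian_map_toBlocks₁₁ {x // x ≠ j} (Fin (ν + n)),
      ← inverseGramGaussian_map_reindex _ E,
      inverseGramGaussian_congr_right ι' F,
      Measure.map_map (measurable_id'.matrix_submatrix _ _) (measurable_id'.matrix_submatrix _ _),
      Measure.map_map ((measurable_id'.matrix_submatrix _ _).comp
        (measurable_id'.matrix_submatrix _ _)) (measurable_id'.matrix_submatrix _ _)]
    rfl

/-- The law `IW(δ, 1)`. -/
noncomputable def stdInverseWishart (δ : ℕ) (ι : Type*) [Fintype ι] [DecidableEq ι] :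
    Measure (Matrix ι ι ℝ) :=
  inverseGramGaussian ι (Fin (δ + Fintype.card ι - 1))

instance (δ : ℕ) (ι : Type*) [Fintype ι] [DecidableEq ι] :
    IsProbabilityMeasure (stdInverseWishart δ ι) := by
  unfold stdInverseWishart; infer_instance

theorem stdInverseWishart_map_submatrix {δ : ℕ} (hδ : 0 < δ) {ι ι' : Type*} [Fintype ι]
    [DecidableEq ι] [Fintype ι'] [DecidableEq ι'] {e : ι → ι'} (he : Function.Injective e) :
    (stdInverseWishart δ ι').map (fun W => W.submatrix e e) = stdInverseWishart δ ι := by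
  have hcard := Fintype.card_le_of_injective e he
  -- Positivity of `δ` keeps the natural subtraction from truncating when `ι` is empty.
  have hν : δ + Fintype.card ι' - 1 =
    (δ + Fintype.card ι - 1) + (Fintype.card ι' - Fintype.card ι) := by omega
  rw [stdInverseWishart, stdInverseWishart, hν]
  exact inverseGramGaussian_map_submatrix _ e he (by omega)

theorem Matrix.measurable_conj {ι κ : Type*} [Fintype κ] (C : Matrix ι κ ℝ) :
    Measurable fun W : Matrix κ κ ℝ => C * W * Cᵀ :=
  (measurable_const.matrix_mul measurable_id').matrix_mul measurable_const

/-- Padding `A` and `B` with zero columns to the common width `p ⊕ p'` changes neither law, by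
consistency. The padded matrices differ by an orthogonal factor, which the standard law absorbs. -/
theorem stdInverseWishart_map_conj_eq {δ : ℕ} (hδ : 0 < δ) {q p p' : Type*} [Fintype q]
    [DecidableEq q] [Fintype p] [DecidableEq p] [Fintype p'] [DecidableEq p']
    {A : Matrix q p ℝ} {B : Matrix q p' ℝ} (h : A * Aᵀ = B * Bᵀ) :
    (stdInverseWishart δ p).map (fun W => A * W * Aᵀ) =
      (stdInverseWishart δ p').map (fun W => B * W * Bᵀ) := by
  let A' : Matrix q (p ⊕ p') ℝ := fromCols A 0
  let B' : Matrix q (p ⊕ p') ℝ := fromCols 0 B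
  have hA'T : A'ᵀ = fromRows Aᵀ 0 := transpose_fromCols A 0
  have hB'T : B'ᵀ = fromRows 0 Bᵀ := transpose_fromCols 0 B
  have hAB : A' * A'ᵀ = B' * B'ᵀ := by
    rw [hA'T, hB'T, fromCols_mul_fromRows, fromCols_mul_fromRows, h]
    simp
  obtain ⟨O, hO, hAO⟩ := Matrix.exists_orthogonal_of_mul_transpose_eq hAB
  have hA : (fun W => A * W * Aᵀ) ∘ (fun W : Matrix (p ⊕ p') (p ⊕ p') ℝ =>
      W.submatrix Sum.inl Sum.inl) = fun W => A' * W * A'ᵀ := by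
    ext1 W
    obtain ⟨P, Q, R, S, rfl⟩ : ∃ P Q R S, W = fromBlocks P Q R S :=
      ⟨_, _, _, _, (fromBlocks_toBlocks W).symm⟩
    rw [hA'T, fromCols_mul_fromBlocks, fromCols_mul_fromRows]
    simp
    rfl
  have hB : (fun W => B * W * Bᵀ) ∘ (fun W : Matrix (p ⊕ p') (p ⊕ p') ℝ =>
      W.submatrix Sum.inr Sum.inr) = fun W => B' * W * B'ᵀ := by
    ext1 W
    obtain ⟨P, Q, R, S, rfl⟩ : ∃ P Q R S, W = fromBlocks P Q R S :=
      ⟨_, _, _, _, (fromBlocks_toBlocks W).symm⟩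
    rw [hB'T, fromCols_mul_fromBlocks, fromCols_mul_fromRows]
    simp
    rfl
  have hconj : (stdInverseWishart δ (p ⊕ p')).map (fun W => O * W * Oᵀ) =
      stdInverseWishart δ (p ⊕ p') :=
    inverseGramGaussian_map_conj (mul_eq_one_comm.1 hO)
  rw [← stdInverseWishart_map_submatrix hδ (Sum.inl_injective (α := p) (β := p')),
    ← stdInverseWishart_map_submatrix hδ (Sum.inr_injective (α := p) (β := p')),
    Measure.map_map (measurable_conj A) (measurable_id'.matrix_submatrix _ _),
    Measure.map_map (measurable_conj B) (measurable_id'.matrix_submatrix _ _), hA, hB, ← hAO]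
  conv_lhs => rw [← hconj, Measure.map_map (measurable_conj A') (measurable_conj O)]
  congr 1
  ext1 W
  simp only [Function.comp_apply, transpose_mul, Matrix.mul_assoc]

end StdInverseWishart

/-! ### Inverse-Wishart laws with positive semi-definite scale -/

section InverseWishart

open Matrix
open scoped MatrixOrder

theorem Matrix.transpose_sqrt {ι : Type*} [Fintype ι] [DecidableEq ι] (S : Matrix ι ι ℝ) :
    (CFC.sqrt S)ᵀ = CFC.sqrt S := by
  have := (CFC.sqrt_nonneg S).isSelfAdjoint
  rw [isSelfAdjoint_iff, star_eq_conjTranspose, conjTranspose_eq_transpose_of_trivial] at this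
  exact this

theorem Matrix.sum_vecMulVec_mulVec {R ι ι' κ : Type*} [CommRing R] [Fintype ι] [Fintype κ]
    (A : Matrix ι' ι R) (X : Matrix κ ι R) :
    ∑ k, vecMulVec (A *ᵥ X k) (A *ᵥ X k) = A * (Xᵀ * X) * Aᵀ := by
  have : A * (Xᵀ * X) * Aᵀ = (X * Aᵀ)ᵀ * (X * Aᵀ) := by
    simp only [transpose_mul, transpose_transpose, Matrix.mul_assoc]
  rw [this]
  ext i j
  simp [Matrix.sum_apply, vecMulVec_apply, Matrix.mul_apply, mulVec, dotProduct, mul_comm]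

theorem wishart_eq_map_gaussianMatrix {ι : Type*} [Fintype ι] [DecidableEq ι] (ν : ℕ)
    (S : Matrix ι ι ℝ) :
    wishart ν S = (gaussianMatrix ι (Fin ν)).map
      fun Y => CFC.sqrt S * (Y * Yᵀ) * CFC.sqrt S := by
  let R := CFC.sqrt S
  have hR : Rᵀ = R := Matrix.transpose_sqrt S
  have hrow : multivariateGaussian (0 : EuclideanSpace ℝ ι) S =
      (Measure.pi fun _ : ι => gaussianReal 0 1).map fun x => WithLp.toLp 2 (R *ᵥ x) := by
    rw [multivariateGaussian, ← map_pi_eq_stdGaussian,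
      Measure.map_map (by fun_prop) (by fun_prop)]
    congr 1
    ext1 x
    simp only [Function.comp_apply, zero_add]
    rfl
  have hm : Measurable fun x : ι → ℝ => (WithLp.toLp 2 (R *ᵥ x) : EuclideanSpace ℝ ι) := by
    refine (PiLp.continuous_toLp 2 _).measurable.comp (measurable_pi_lambda _ fun i => ?_)
    simp only [mulVec, dotProduct]
    fun_prop
  have hsum : Measurable fun x : Fin ν → EuclideanSpace ℝ ι =>
      ∑ k, Matrix.vecMulVec (x k).ofLp (x k).ofLp := Matrix.measurable_of_entries fun i j => by
    simp only [Matrix.sum_apply, vecMulVec_apply]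
    fun_prop
  have : IsProbabilityMeasure
      ((Measure.pi fun _ : ι => gaussianReal 0 1).map fun x : ι → ℝ =>
        (WithLp.toLp 2 (R *ᵥ x) : EuclideanSpace ℝ ι)) :=
    Measure.isProbabilityMeasure_map hm.aemeasurable
  have hpi := Measure.pi_map_pi (ι := Fin ν) (μ := fun _ => Measure.pi fun _ : ι => gaussianReal 0 1)
    (f := fun _ x => (WithLp.toLp 2 (R *ᵥ x) : EuclideanSpace ℝ ι)) fun _ => hm.aemeasurable
  have hconj : Measurable fun Y : Matrix ι (Fin ν) ℝ => R * (Y * Yᵀ) * R :=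
    (measurable_const.matrix_mul
      (measurable_id'.matrix_mul measurable_id'.matrix_transpose)).matrix_mul measurable_const
  rw [wishart, hrow, ← hpi, Measure.map_map hsum (by fun_prop),
    ← gaussianMatrix_map_transpose, Measure.map_map hconj measurable_id'.matrix_transpose]
  change Measure.map _ (gaussianMatrix (Fin ν) ι) = _
  congr 1
  ext1 X
  refine (Matrix.sum_vecMulVec_mulVec R (Matrix.of X)).trans ?_
  rw [hR]
  rfl

/-- `IW(δ, Ψ)` is the congruence image of `IW(δ, 1)` under some square root of `Ψ`. -/
theorem exists_inverseWishart_eq_map {ι : Type*} [Fintype ι] [DecidableEq ι] (δ : ℕ)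
    {Ψ : Matrix ι ι ℝ} (hΨ : Ψ.PosSemidef) :
    ∃ B : Matrix ι ι ℝ, B * Bᵀ = Ψ ∧
      inverseWishart δ Ψ = (stdInverseWishart δ ι).map fun W => B * W * Bᵀ := by
  -- Valid for every `S`, since the total inverse always reverses products.
  have key : ∀ S : Matrix ι ι ℝ, inverseWishartOfPosDef δ S =
      (stdInverseWishart δ ι).map
        fun W => (CFC.sqrt S⁻¹)⁻¹ * W * ((CFC.sqrt S⁻¹)⁻¹)ᵀ := fun S => by
    rw [inverseWishartOfPosDef, wishart_eq_map_gaussianMatrix, stdInverseWishart,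
      inverseGramGaussian, Measure.map_map (measurable_conj _) measurable_inverseGram,
      Measure.map_map measurable_id'.matrix_inv ((measurable_const.matrix_mul
      (measurable_id'.matrix_mul measurable_id'.matrix_transpose)).matrix_mul measurable_const)]
    congr 1
    ext1 Y
    simp only [Function.comp_apply]
    rw [Matrix.mul_inv_rev, Matrix.mul_inv_rev, transpose_nonsing_inv,
      Matrix.transpose_sqrt, Matrix.mul_assoc]
  by_cases h : Ψ.PosDef
  · refine ⟨(CFC.sqrt Ψ⁻¹)⁻¹, ?_, by rw [inverseWishart, if_pos h, key]⟩
    rw [transpose_nonsing_inv, Matrix.transpose_sqrt, ← Matrix.mul_inv_rev,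
      CFC.sqrt_mul_sqrt_self _ h.inv.posSemidef.nonneg,
      Matrix.nonsing_inv_nonsing_inv _ ((Matrix.isUnit_iff_isUnit_det _).1 h.isUnit)]
  · have hone : inverseWishartOfPosDef δ (1 : Matrix ι ι ℝ) = stdInverseWishart δ ι := by
      rw [key]
      simp
    refine ⟨CFC.sqrt Ψ, ?_, ?_⟩
    · rw [Matrix.transpose_sqrt, CFC.sqrt_mul_sqrt_self _ hΨ.nonneg]
    · rw [inverseWishart, if_neg h, hone]
      simp only [Matrix.transpose_sqrt]

theorem isProbabilityMeasure_inverseWishart {ι : Type*} [Fintype ι] [DecidableEq ι] (δ : ℕ)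
    {Ψ : Matrix ι ι ℝ} (hΨ : Ψ.PosSemidef) : IsProbabilityMeasure (inverseWishart δ Ψ) := by
  obtain ⟨B, -, hB⟩ := exists_inverseWishart_eq_map δ hΨ
  rw [hB]
  exact Measure.isProbabilityMeasure_map (measurable_conj B).aemeasurable

/-- The principal submatrices of an Inverse-Wishart matrix are Inverse-Wishart. -/
theorem inverseWishart_map_submatrix {ι ι' : Type*} [Fintype ι] [DecidableEq ι] [Fintype ι']
    [DecidableEq ι'] {δ : ℕ} (hδ : 0 < δ) {Ψ : Matrix ι ι ℝ} (hΨ : Ψ.PosSemidef) (e : ι' → ι) :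
    (inverseWishart δ Ψ).map (fun W => W.submatrix e e) = inverseWishart δ (Ψ.submatrix e e) := by
  obtain ⟨B, hB, hB'⟩ := exists_inverseWishart_eq_map δ hΨ
  obtain ⟨C, hC, hC'⟩ := exists_inverseWishart_eq_map δ (hΨ.submatrix e)
  -- Both factors have Gram matrix `Ψ.submatrix e e`. The left one is rectangular in general, and
  -- `e` may repeat rows.
  have h : B.submatrix e id * (B.submatrix e id)ᵀ = C * Cᵀ := by
    rw [hC, ← hB]
    rfl
  rw [hB', hC', ← stdInverseWishart_map_conj_eq hδ h,
    Measure.map_map (measurable_id'.matrix_submatrix _ _) (measurable_conj B)]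
  rfl

end InverseWishart

/-! ### Finite-dimensional laws of the process -/

section InverseWishartProcess

open Matrix

variable {T : Type*}

theorem measurable_gridMatrix (t : Finset T) : Measurable (gridMatrix t) :=
  Matrix.measurable_of_entries fun i j => measurable_pi_apply (i.1, j.1)

open Classical in
/-- The set of all points of `T` that occur as a coordinate of a point of a finite set of pairs. -/
noncomputable def coordinateFinset (I : Finset (T × T)) : Finset T :=
  I.image Prod.fst ∪ I.image Prod.snd

theorem mem_coordinateFinset_of_mem {I : Finset (T × T)} :
    ∀ p ∈ I, p.1 ∈ coordinateFinset I ∧ p.2 ∈ coordinateFinset I := by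
  classical
  exact fun p hp => ⟨Finset.mem_union_left _ (Finset.mem_image_of_mem _ hp),
    Finset.mem_union_right _ (Finset.mem_image_of_mem _ hp)⟩

/-- Evaluation of a matrix on a grid containing a given finite set of pairs. -/
def gridEval {t : Finset T} {I : Finset (T × T)} (h : ∀ p ∈ I, p.1 ∈ t ∧ p.2 ∈ t)
    (M : Matrix t t ℝ) : I → ℝ :=
  fun p => M ⟨p.1.1, (h p.1 p.2).1⟩ ⟨p.1.2, (h p.1 p.2).2⟩

theorem measurable_gridEval {t : Finset T} {I : Finset (T × T)}
    (h : ∀ p ∈ I, p.1 ∈ t ∧ p.2 ∈ t) : Measurable (gridEval h) :=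
  measurable_pi_lambda _ fun _ => Matrix.measurable_entry _ _

open Classical in
/-- The finite-dimensional laws of an Inverse-Wishart process. -/
noncomputable def inverseWishartFamily (δ : ℕ) (Ψ : T × T → ℝ) (I : Finset (T × T)) :
    Measure (I → ℝ) :=
  (inverseWishart δ (gridMatrix (coordinateFinset I) Ψ)).map (gridEval mem_coordinateFinset_of_mem)

open Classical in
theorem inverseWishart_gridMatrix_map {δ : ℕ} (hδ : 0 < δ) {Ψ : T × T → ℝ}
    (hΨ : IsPosSemidefKernel Ψ) {s t : Finset T} (h : s ⊆ t) :
    (inverseWishart δ (gridMatrix t Ψ)).map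
        (fun W => W.submatrix (fun i : s => (⟨i, h i.2⟩ : t)) fun i : s => (⟨i, h i.2⟩ : t)) =
      inverseWishart δ (gridMatrix s Ψ) :=
  inverseWishart_map_submatrix hδ (hΨ t) _

-- Consistency makes the choice of grid irrelevant, so the laws for `J ⊆ I` can be compared on one
-- grid.
open Classical in
theorem inverseWishartFamily_eq {δ : ℕ} (hδ : 0 < δ) {Ψ : T × T → ℝ}
    (hΨ : IsPosSemidefKernel Ψ) {t : Finset T} {I : Finset (T × T)}
    (h : ∀ p ∈ I, p.1 ∈ t ∧ p.2 ∈ t) :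
    inverseWishartFamily δ Ψ I = (inverseWishart δ (gridMatrix t Ψ)).map (gridEval h) := by
  have hsub : coordinateFinset I ⊆ t := fun x hx => by
    rcases Finset.mem_union.1 hx with hx | hx <;> obtain ⟨p, hp, rfl⟩ := Finset.mem_image.1 hx
    exacts [(h p hp).1, (h p hp).2]
  rw [inverseWishartFamily, ← inverseWishart_gridMatrix_map hδ hΨ hsub,
    Measure.map_map (measurable_gridEval _) (measurable_id'.matrix_submatrix _ _)]
  rfl

theorem isProjectiveMeasureFamily_inverseWishartFamily {δ : ℕ} (hδ : 0 < δ) {Ψ : T × T → ℝ}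
    (hΨ : IsPosSemidefKernel Ψ) :
    IsProjectiveMeasureFamily (α := fun _ : T × T => ℝ) (inverseWishartFamily δ Ψ) := by
  intro I J hJI
  rw [inverseWishartFamily_eq hδ hΨ fun p hp => mem_coordinateFinset_of_mem p (hJI hp),
    inverseWishartFamily]
  exact (Measure.map_map (Finset.measurable_restrict₂ (X := fun _ : T × T => ℝ) hJI)
    (measurable_gridEval _)).symm

theorem isProbabilityMeasure_inverseWishartFamily (δ : ℕ) {Ψ : T × T → ℝ}
    (hΨ : IsPosSemidefKernel Ψ) (I : Finset (T × T)) :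
    IsProbabilityMeasure (inverseWishartFamily δ Ψ I) := by
  classical
  have := isProbabilityMeasure_inverseWishart δ (hΨ (coordinateFinset I))
  exact Measure.isProbabilityMeasure_map (measurable_gridEval _).aemeasurable

/-- Every finite set of pairs lies in a square grid, so the laws on grids and on arbitrary finite
sets of pairs determine each other. -/
theorem isInverseWishartProcess_iff_isProjectiveLimit {δ : ℕ} (hδ : 0 < δ) {Ψ : T × T → ℝ}
    (hΨ : IsPosSemidefKernel Ψ) {μ : Measure (T × T → ℝ)} :
    IsInverseWishartProcess δ Ψ μ ↔
      IsProjectiveLimit (α := fun _ => ℝ) μ (inverseWishartFamily δ Ψ) := by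
  classical
  have := isProbabilityMeasure_inverseWishartFamily δ hΨ
  constructor
  · intro hμ I
    rw [inverseWishartFamily]
    have := hμ.2 (coordinateFinset I)
    rw [← this, Measure.map_map (measurable_gridEval _) (measurable_gridMatrix _)]
    rfl
  · intro hμ
    refine ⟨hμ.isProbabilityMeasure, fun t => ?_⟩
    have hmem : ∀ p ∈ t ×ˢ t, p.1 ∈ t ∧ p.2 ∈ t := fun p hp => Finset.mem_product.1 hp
    let f : ((t ×ˢ t : Finset (T × T)) → ℝ) → Matrix t t ℝ := fun x =>
      Matrix.of fun i j => x ⟨(i, j), Finset.mk_mem_product i.2 j.2⟩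
    have hf : Measurable f := Matrix.measurable_of_entries fun i j => measurable_pi_apply _
    have h := congrArg (Measure.map f) (hμ (t ×ˢ t))
    rw [inverseWishartFamily_eq hδ hΨ hmem,
      Measure.map_map hf (Finset.measurable_restrict _),
      Measure.map_map hf (measurable_gridEval _)] at h
    refine h.trans ?_
    exact Measure.map_id

end InverseWishartProcess

theorem proposition1 (T : Set ℝ) (hT : IsCompact T) (δ : ℕ) (hδ : 4 < δ)
    (Ψ : T × T → ℝ) (hΨ : IsPosSemidefKernel Ψ) :
    ∃! μ : Measure (T × T → ℝ), IsInverseWishartProcess δ Ψ μ := by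
  have hδ' : 0 < δ := by omega
  have := isProbabilityMeasure_inverseWishartFamily δ hΨ
  obtain ⟨μ, hμ⟩ := exists_isProjectiveLimit_real
    (isProjectiveMeasureFamily_inverseWishartFamily hδ' hΨ)
  exact ⟨μ, (isInverseWishartProcess_iff_isProjectiveLimit hδ' hΨ).2 hμ, fun ρ hρ =>
    ((isInverseWishartProcess_iff_isProjectiveLimit hδ' hΨ).1 hρ).unique hμ⟩
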